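/- **Theorem (Stability of entanglement).** Let $\mathcal H_R$ be a finite-dimensional complex Hilbert space (the radiation quanta $\{r_i\}$ emitted up to time $t_n$, e.g. $(\mathbb C^2)^{\otimes n}$), and let $\mathcal H$, $\mathcal H'$ be complex inner product spaces of arbitrary dimension (the matter and the infallen quanta $(M,\{l_i\})$ in the black hole at time $t_n$, and the same system after the next step; for instance $\mathcal H'=\mathcal H$). For a unit vector $\Phi$ in a tensor product of an outside system and an inside system, the entanglement entropy of the outside system is $-\operatorname{tr}(\rho\log\rho)$, where $\rho$ is the reduced density matrix of $\Phi$ on the outside system and $\log$ is the natural logarithm. Let $\Psi\in\mathcal H_R\otimes\mathcal H$ be the normalized state at time $t_n$, and let $S_0$ be the entanglement entropy of $\{r_i\}$ in $\Psi$. At the step to $t_{n+1}$ a new pair of two-level quanta $(l_{n+1},r_{n+1})$ is created in the span of $$S^{(1)}=\tfrac1{\sqrt2}\bigl(|0\rangle_{l_{n+1}}|0\rangle_{r_{n+1}}+|1\rangle_{l_{n+1}}|1\rangle_{r_{n+1}}\bigr),\qquad S^{(2)}=\tfrac1{\sqrt2}\bigl(|0\rangle_{l_{n+1}}|0\rangle_{r_{n+1}}-|1\rangle_{l_{n+1}}|1\rangle_{r_{n+1}}\bigr),$$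 the earlier radiation is left unchanged, and the hole evolves by $\psi\mapsto S^{(1)}\otimes K_1\psi+S^{(2)}\otimes K_2\psi$, where $K_1,K_2:\mathcal H\to\mathcal H'$ are linear and the evolution preserves norms, i.e. $\|K_1\psi\|^2+\|K_2\psi\|^2=\|\psi\|^2$ for all $\psi\in\mathcal H$. Thus the state at $t_{n+1}$ is $$S^{(1)}\Lambda^{(1)}+S^{(2)}\Lambda^{(2)},\qquad \Lambda^{(i)}=(1\otimes K_i)\Psi\in\mathcal H_R\otimes\mathcal H'.$$ If $\varepsilon$ is a real number with $\|\Lambda^{(2)}\|<\varepsilon$, then the entanglement entropy of $(\{r_i\},r_{n+1})$ with the inside system $(l_{n+1},\mathcal H')$ in the state at $t_{n+1}$ satisfies $$S(\{r_i\},r_{n+1})>S_0+\log 2-2\varepsilon .$$ -/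

import Mathlib

/-- The Hilbert space `ℂ^X ⊗ H` of a composite system: a finite-dimensional system with orthonormal
basis `(|x⟩)_{x : X}` and a second system with state space `H`. The vector `∑ x, |x⟩ ⊗ Ψ_x` is
represented by its family of components `Ψ_x : H`. -/
abbrev Composite (X : Type*) (H : Type*) := PiLp 2 (fun _ : X => H)

/-- The reduced density matrix on `ℂ^X` of the vector `Ψ = ∑ x, |x⟩ ⊗ Ψ_x`, that is the partial
trace of `|Ψ⟩⟨Ψ| = ∑ x y, |x⟩⟨y| ⊗ |Ψ_x⟩⟨Ψ_y|` over `H`. -/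
noncomputable def reducedDensity {X H : Type*} [NormedAddCommGroup H]
    [InnerProductSpace ℂ H] (Ψ : Composite X H) : Matrix X X ℂ :=
  Matrix.of fun x y => inner ℂ (Ψ y) (Ψ x)

theorem reducedDensity_isHermitian {X H : Type*} [NormedAddCommGroup H]
    [InnerProductSpace ℂ H] (Ψ : Composite X H) : (reducedDensity Ψ).IsHermitian := by
  ext x y
  simp [reducedDensity, Matrix.conjTranspose_apply]

/-- The von Neumann entropy `-tr (ρ log ρ) = -∑ i, ρ_i log ρ_i` of a Hermitian matrix `ρ` with
eigenvalues `ρ_i` counted with multiplicity (natural logarithm, `0 log 0 = 0`). -/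
noncomputable def vonNeumannEntropy {X : Type*} [Fintype X] [DecidableEq X]
    {ρ : Matrix X X ℂ} (hρ : ρ.IsHermitian) : ℝ :=
  ∑ i, Real.negMulLog (hρ.eigenvalues i)

/-- The entanglement entropy of the first system (`ℂ^X`) with the second one (`H`) in the pure
state `Ψ`. -/
noncomputable def entanglementEntropy {X H : Type*} [Fintype X] [DecidableEq X]
    [NormedAddCommGroup H] [InnerProductSpace ℂ H] (Ψ : Composite X H) : ℝ :=
  vonNeumannEntropy (reducedDensity_isHermitian Ψ)

/-- The state space of the new pair; the basis vector with index `(i, j)` is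
`|i⟩_l |j⟩_r`, where `l` is the infalling and `r` the outgoing quantum. -/
abbrev PairSpace := EuclideanSpace ℂ (Fin 2 × Fin 2)

/-- `S⁽¹⁾ = (|0⟩_l |0⟩_r + |1⟩_l |1⟩_r) / √2`. -/
noncomputable def bellPlus : PairSpace :=
  ((1 / Real.sqrt 2 : ℝ) : ℂ) •
    (EuclideanSpace.single (0, 0) 1 + EuclideanSpace.single (1, 1) 1)

/-- `S⁽²⁾ = (|0⟩_l |0⟩_r - |1⟩_l |1⟩_r) / √2`. -/
noncomputable def bellMinus : PairSpace :=
  ((1 / Real.sqrt 2 : ℝ) : ℂ) •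
    (EuclideanSpace.single (0, 0) 1 - EuclideanSpace.single (1, 1) 1)

/-- The product `S ⊗ Λ` of a pair state `S` and a state `Λ` of the earlier radiation (`ℂ^R`) and the
hole (`H`). It is regarded as a state of the outside system `ℂ^R ⊗ ℂ²_r`, consisting of the earlier
radiation and the new outgoing quantum, and of the inside system `ℂ²_l ⊗ H`, consisting of the new
infalling quantum and the hole. -/
noncomputable def pairTensor {R H : Type*} [NormedAddCommGroup H] [InnerProductSpace ℂ H]
    (S : PairSpace) (Λ : Composite R H) : Composite (R × Fin 2) (Composite (Fin 2) H) :=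
  WithLp.toLp 2 fun a => WithLp.toLp 2 fun l => S (l, a.2) • Λ a.1

/-- The operator `1 ⊗ K` from `ℂ^R ⊗ H` to `ℂ^R ⊗ H'`. -/
noncomputable def applyHole {R H H' : Type*} [NormedAddCommGroup H] [InnerProductSpace ℂ H]
    [NormedAddCommGroup H'] [InnerProductSpace ℂ H'] (K : H →ₗ[ℂ] H') (Ψ : Composite R H) :
    Composite R H' :=
  WithLp.toLp 2 fun a => K (Ψ a)

/-!
Write `ρ(Φ)` for the reduced density matrix of `Φ` and `S(A)` for `-tr (A log A)`. The new pair is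
diagonal in the computational basis, so the new reduced density matrix is block diagonal with blocks
`ρ(Λ₁ + Λ₂) / 2` and `ρ(Λ₁ - Λ₂) / 2`, and its entropy is
`log 2 + (S(ρ(Λ₁ + Λ₂)) + S(ρ(Λ₁ - Λ₂))) / 2` (`entanglementEntropy_pairTensor`). Norm preservation
gives `ρ(Λ₁) + ρ(Λ₂) = ρ(Ψ)` by polarization, hence `ρ(Λ₁ ± Λ₂) = ρ(Ψ) ± D` where `D` collects the
cross terms. What has to be bounded is therefore the concavity defect
`2 S(A) - S(A + D) - S(A - D)` at `A = ρ(Ψ)`, independently of the dimension.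

If `D = P - Q` with `P`, `Q` positive, then this defect is at most `2 log 2 (tr P + tr Q)`
(`two_mul_spectralEntropy_le`). Indeed the derivative of `-S(A + t D) - S(A - t D)` is
`tr D (log (A + t D) - log (A - t D))`. Positivity of `A ± D` gives
`A + t D ≤ (1 + t) / (1 - t) • (A - t D)`, and the same with `D` replaced by `-D`. As the logarithm
is operator monotone, the difference of logarithms lies between `± log ((1 + t) / (1 - t))`, so the
derivative is at most `log ((1 + t) / (1 - t)) (tr P + tr Q)`; and
`∫₀¹ log ((1 + t) / (1 - t)) dt = 2 log 2`. Klein's inequality (`spectralEntropy_le_tangent`)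
replaces the derivative by finite increments.

The polarization `D = ρ(p Λ₁ + p⁻¹ Λ₂) / 2 - ρ(p Λ₁ - p⁻¹ Λ₂) / 2` with `p² = ε` has
`tr P + tr Q = ε ‖Λ₁‖² + ‖Λ₂‖² / ε < 2 ε`, and the theorem follows from `log 2 < 1`.
-/

section

open scoped MatrixOrder Matrix.Norms.L2Operator ComplexOrder
open Matrix

/-! ### The entropy of a matrix as a spectral sum -/

/-- The von Neumann entropy `-tr (A log A)`, as a sum over the roots of the characteristic
polynomial. Unlike `vonNeumannEntropy` it needs no proof that `A` is Hermitian, so it can be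
rewritten along equalities of matrices. Only the real parts of the roots enter, which loses nothing
for Hermitian `A`. -/
noncomputable def spectralEntropy {X : Type*} [Fintype X] [DecidableEq X] (A : Matrix X X ℂ) : ℝ :=
  (A.charpoly.roots.map fun z => Real.negMulLog z.re).sum

theorem spectralEntropy_cfc {X : Type*} [Fintype X] [DecidableEq X] {A : Matrix X X ℂ}
    (hA : A.IsHermitian) (f : ℝ → ℝ) :
    spectralEntropy (cfc f A) = ∑ i, Real.negMulLog (f (hA.eigenvalues i)) := by
  have h := hA.charpoly_cfc_eq f
  have hr : (∏ i, (Polynomial.X - Polynomial.C ((f (hA.eigenvalues i) : ℝ) : ℂ))).roots =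
      Finset.univ.val.map fun i => ((f (hA.eigenvalues i) : ℝ) : ℂ) := by
    rw [← Polynomial.roots_multiset_prod_X_sub_C
      (Finset.univ.val.map fun i => ((f (hA.eigenvalues i) : ℝ) : ℂ)), Multiset.map_map]
    rfl
  rw [spectralEntropy, h]
  erw [hr]
  simp

theorem spectralEntropy_eq_sum {X : Type*} [Fintype X] [DecidableEq X] {A : Matrix X X ℂ}
    (hA : A.IsHermitian) :
    spectralEntropy A = ∑ i, Real.negMulLog (hA.eigenvalues i) := by
  rw [spectralEntropy, hA.roots_charpoly_eq_eigenvalues]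
  simp

theorem spectralEntropy_smul {X : Type*} [Fintype X] [DecidableEq X] {A : Matrix X X ℂ}
    (hA : A.IsHermitian) (r : ℝ) :
    spectralEntropy (r • A) = r * spectralEntropy A + Real.negMulLog r * A.trace.re := by
  have h : r • A = cfc (fun x : ℝ => r • x) A := by
    rw [cfc_smul_id r A hA.isSelfAdjoint]
  rw [h, spectralEntropy_cfc hA, spectralEntropy_eq_sum hA, hA.trace_eq_sum_eigenvalues]
  simp only [smul_eq_mul, Real.negMulLog_mul, Finset.sum_add_distrib, Complex.re_sum,
    Complex.coe_algebraMap, Complex.ofReal_re, Finset.mul_sum]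
  rw [add_comm]
  simp [mul_comm]

theorem spectralEntropy_add_smul_one {X : Type*} [Fintype X] [DecidableEq X] {A : Matrix X X ℂ}
    (hA : A.IsHermitian) (s : ℝ) :
    spectralEntropy (A + s • (1 : Matrix X X ℂ)) =
      ∑ i, Real.negMulLog (hA.eigenvalues i + s) := by
  have h : A + s • (1 : Matrix X X ℂ) = cfc (fun x : ℝ => x + s) A := by
    rw [cfc_add_const s (fun x : ℝ => x) A (by fun_prop) hA.isSelfAdjoint,
      cfc_id' ℝ A hA.isSelfAdjoint, Algebra.algebraMap_eq_smul_one]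
  rw [h, spectralEntropy_cfc hA]

theorem spectralEntropy_fromBlocks {X Y : Type*} [Fintype X] [DecidableEq X] [Fintype Y]
    [DecidableEq Y] (A : Matrix X X ℂ) (B : Matrix Y Y ℂ) :
    spectralEntropy (fromBlocks A 0 0 B) = spectralEntropy A + spectralEntropy B := by
  rw [spectralEntropy, charpoly_fromBlocks_zero₁₂, Polynomial.roots_mul
    (mul_ne_zero (charpoly_monic A).ne_zero (charpoly_monic B).ne_zero)]
  simp [spectralEntropy]

theorem spectralEntropy_submatrix_equiv {X Y : Type*} [Fintype X] [DecidableEq X] [Fintype Y]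
    [DecidableEq Y] (A : Matrix X X ℂ) (e : Y ≃ X) :
    spectralEntropy (A.submatrix e e) = spectralEntropy A := by
  have := charpoly_reindex e.symm A
  rw [spectralEntropy, spectralEntropy, ← this]
  rfl

/-! ### Klein's inequality -/

/-- The weights `w i j` are the squared overlaps of the eigenvectors of `A` and `B`; they do not
depend on `f` and `g`. -/
theorem exists_trace_cfc_mul_cfc {X : Type*} [Fintype X] [DecidableEq X] {A B : Matrix X X ℂ}
    (hA : A.IsHermitian) (hB : B.IsHermitian) :
    ∃ w : X → X → ℝ, (∀ i j, 0 ≤ w i j) ∧ ∀ f g : ℝ → ℝ, (cfc f A * cfc g B).trace.re =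
      ∑ i, ∑ j, w i j * (f (hA.eigenvalues i) * g (hB.eigenvalues j)) := by
  let U : Matrix X X ℂ := hA.eigenvectorUnitary
  let V : Matrix X X ℂ := hB.eigenvectorUnitary
  let W := star U * V
  refine ⟨fun i j => Complex.normSq (W i j), fun i j => Complex.normSq_nonneg _, fun f g => ?_⟩
  rw [hA.cfc_eq, hB.cfc_eq, IsHermitian.cfc, IsHermitian.cfc, Unitary.conjStarAlgAut_apply,
    Unitary.conjStarAlgAut_apply]
  have h : ∀ D E : Matrix X X ℂ, (U * D * star U * (V * E * star V)).trace =
      (D * W * (E * star W)).trace := by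
    intro D E
    rw [star_mul, star_star, Matrix.mul_assoc, Matrix.mul_assoc, Matrix.trace_mul_comm]
    simp only [W, Matrix.mul_assoc]
  erw [h]
  simp only [Matrix.trace, Matrix.diag, Matrix.mul_apply (M := diagonal _ * W), diagonal_mul,
    Complex.re_sum]
  refine Finset.sum_congr rfl fun i _ => Finset.sum_congr rfl fun j _ => ?_
  simp [Matrix.star_apply, Complex.normSq_apply]
  ring

theorem trace_cfc_re {X : Type*} [Fintype X] [DecidableEq X] {A : Matrix X X ℂ}
    (hA : A.IsHermitian) (f : ℝ → ℝ) :
    (cfc f A).trace.re = ∑ i, f (hA.eigenvalues i) := by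
  rw [hA.cfc_eq, IsHermitian.cfc, Unitary.conjStarAlgAut_apply, Matrix.trace_mul_comm,
    ← Matrix.mul_assoc]
  simp [Matrix.trace]

/-- The graph of `Real.negMulLog` lies below its tangents. -/
theorem negMulLog_le_tangent {a b : ℝ} (ha : 0 ≤ a) (hb : 0 < b) :
    Real.negMulLog a ≤ Real.negMulLog b + (b - a) * (Real.log b + 1) := by
  rcases ha.eq_or_lt with rfl | ha
  · simp [Real.negMulLog]; nlinarith
  · have h := Real.log_le_sub_one_of_pos (div_pos hb ha)
    rw [Real.log_div hb.ne' ha.ne'] at h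
    have h' := mul_le_mul_of_nonneg_left h ha.le
    have : a * (b / a - 1) = b - a := by field_simp
    simp only [Real.negMulLog]
    nlinarith

/-- **Klein's inequality**: the graph of the von Neumann entropy lies below its tangents. In the
eigenbases of `A` and `B` it is an average of scalar tangent inequalities. -/
theorem spectralEntropy_le_tangent {X : Type*} [Fintype X] [DecidableEq X] {A B : Matrix X X ℂ}
    (hA : A.PosSemidef) (hB : B.PosDef) :
    spectralEntropy A ≤ spectralEntropy B + ((B - A) * (CFC.log B + 1)).trace.re := by
  obtain ⟨w, hw, h⟩ := exists_trace_cfc_mul_cfc hA.isHermitian hB.isHermitian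
  have hone : cfc (fun _ : ℝ => (1 : ℝ)) A = 1 := cfc_const_one ℝ A hA.isHermitian.isSelfAdjoint
  have hone' : cfc (fun _ : ℝ => (1 : ℝ)) B = 1 := cfc_const_one ℝ B hB.isHermitian.isSelfAdjoint
  have hid : cfc (fun x : ℝ => x) A = A := cfc_id' ℝ A hA.isHermitian.isSelfAdjoint
  have hid' : cfc (fun x : ℝ => x) B = B := cfc_id' ℝ B hB.isHermitian.isSelfAdjoint
  have hlog : CFC.log B + 1 = cfc (fun x : ℝ => Real.log x + 1) B := by
    rw [cfc_add_const 1 Real.log B (Set.Finite.continuousOn (Matrix.finite_real_spectrum) _)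
      hB.isHermitian.isSelfAdjoint]
    simp [CFC.log]
  have hBlog : B * (CFC.log B + 1) = cfc (fun x : ℝ => x * (Real.log x + 1)) B := by
    rw [cfc_mul (fun x : ℝ => x) (fun x : ℝ => Real.log x + 1) B (by fun_prop)
      (Set.Finite.continuousOn (Matrix.finite_real_spectrum) _),
      hid', hlog]
  have e1 : spectralEntropy A =
      ∑ i, ∑ j, w i j * (Real.negMulLog (hA.isHermitian.eigenvalues i) * 1) := by
    rw [← h Real.negMulLog (fun _ => 1), hone', mul_one, trace_cfc_re hA.isHermitian,
      spectralEntropy_eq_sum hA.isHermitian]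
  have e2 : spectralEntropy B =
      ∑ i, ∑ j, w i j * (1 * Real.negMulLog (hB.isHermitian.eigenvalues j)) := by
    rw [← h (fun _ => 1) Real.negMulLog, hone, one_mul, trace_cfc_re hB.isHermitian,
      spectralEntropy_eq_sum hB.isHermitian]
  have e3 := h (fun x => x) (fun x => Real.log x + 1)
  have e4 := h (fun _ => 1) (fun x => x * (Real.log x + 1))
  rw [hid, ← hlog] at e3
  rw [hone, one_mul, ← hBlog] at e4
  rw [sub_mul, trace_sub, Complex.sub_re, e1, e2, e3, e4, ← Finset.sum_sub_distrib,
    ← Finset.sum_add_distrib]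
  refine Finset.sum_le_sum fun i _ => ?_
  rw [← Finset.sum_sub_distrib, ← Finset.sum_add_distrib]
  refine Finset.sum_le_sum fun j _ => ?_
  have := mul_le_mul_of_nonneg_left (negMulLog_le_tangent (hA.eigenvalues_nonneg i)
    (hB.eigenvalues_pos j)) (hw i j)
  linarith

theorem re_trace_mul_nonneg {X : Type*} [Fintype X] [DecidableEq X] {P N : Matrix X X ℂ}
    (hP : P.PosSemidef) (hN : N.PosSemidef) : 0 ≤ (P * N).trace.re := by
  obtain ⟨B, rfl⟩ := CStarAlgebra.nonneg_iff_eq_star_mul_self.1 hP.nonneg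
  rw [Matrix.mul_assoc, Matrix.trace_mul_comm]
  exact (Complex.le_def.1 (hN.mul_mul_conjTranspose_same B).trace_nonneg).1

/-! ### The concavity defect of the von Neumann entropy -/

/-- The function `(1 + t) log (1 + t) + (1 - t) log (1 - t)` is convex, with derivative
`log ((1 + t) / (1 - t))`. -/
theorem sub_mul_log_div_le {t u : ℝ} (ht : 0 ≤ t) (htu : t ≤ u) (hu : u < 1) :
    (u - t) * Real.log ((1 + t) / (1 - t)) ≤
      ((1 + u) * Real.log (1 + u) + (1 - u) * Real.log (1 - u)) -
        ((1 + t) * Real.log (1 + t) + (1 - t) * Real.log (1 - t)) := by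
  have h1 := negMulLog_le_tangent (a := 1 + u) (b := 1 + t) (by linarith) (by linarith)
  have h2 := negMulLog_le_tangent (a := 1 - u) (b := 1 - t) (by linarith) (by linarith)
  rw [Real.log_div (by linarith) (by linarith)]
  simp only [Real.negMulLog] at h1 h2
  linarith

/-- If the increments of `f` are bounded by products of increments, then `f` does not increase:
over a grid of mesh `h` the bounds telescope to `h * (g b - g a)`. No continuity is needed. -/
theorem le_of_increment_le {f g : ℝ → ℝ} {a b : ℝ} (hab : a ≤ b)
    (h : ∀ x y, a ≤ x → x ≤ y → y ≤ b → f y - f x ≤ (y - x) * (g y - g x)) : f b ≤ f a := by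
  have key : ∀ n : ℕ, f b - f a ≤ (b - a) * (g b - g a) / (n + 1 : ℝ) := by
    intro n
    have hn : (0 : ℝ) < n + 1 := by positivity
    let x : ℕ → ℝ := fun k => a + k * ((b - a) / (n + 1))
    have hd : 0 ≤ (b - a) / (n + 1 : ℝ) := div_nonneg (by linarith) hn.le
    have hx0 : x 0 = a := by simp [x]
    have hx1 : x (n + 1) = b := by simp only [x]; push_cast; field_simp; ring
    have hstep : ∀ k, x (k + 1) - x k = (b - a) / (n + 1) := by
      intro k; simp only [x]; push_cast; ring
    have hmono : Monotone x := monotone_nat_of_le_succ fun k => by linarith [hstep k]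
    have h1 : f b - f a = ∑ k ∈ Finset.range (n + 1), (f (x (k + 1)) - f (x k)) := by
      rw [Finset.sum_range_sub (fun k => f (x k)), hx0, hx1]
    have h2 : g b - g a = ∑ k ∈ Finset.range (n + 1), (g (x (k + 1)) - g (x k)) := by
      rw [Finset.sum_range_sub (fun k => g (x k)), hx0, hx1]
    rw [mul_div_right_comm, h1, h2, Finset.mul_sum]
    refine Finset.sum_le_sum fun k hk => ?_
    rw [← hstep k]
    refine h _ _ ?_ (hmono k.le_succ) ?_
    · rw [← hx0]; exact hmono k.zero_le
    · rw [← hx1]; exact hmono (Finset.mem_range.1 hk)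
  have hlim : Filter.Tendsto (fun n : ℕ => (b - a) * (g b - g a) / (n + 1 : ℝ)) Filter.atTop
      (nhds 0) := by
    simpa [div_eq_mul_inv] using tendsto_one_div_add_atTop_nhds_zero_nat.const_mul
      ((b - a) * (g b - g a))
  linarith [ge_of_tendsto' hlim key]

/-- By operator monotonicity of the logarithm, matrices that dominate each other up to a factor `r`
have logarithms differing by at most `log r`. -/
theorem re_trace_mul_log_sub_log_le {X : Type*} [Fintype X] [DecidableEq X]
    {P Q B C : Matrix X X ℂ} (hP : P.PosSemidef) (hQ : Q.PosSemidef) (hB : B.PosDef)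
    (hC : C.PosDef) {r : ℝ} (hr : 0 < r) (hBC : B ≤ r • C) (hCB : C ≤ r • B) :
    ((P - Q) * (CFC.log B - CFC.log C)).trace.re ≤ Real.log r * (P.trace.re + Q.trace.re) := by
  have key : ∀ {B C : Matrix X X ℂ}, B.PosDef → C.PosDef → B ≤ r • C →
      ∀ {P : Matrix X X ℂ}, P.PosSemidef →
      (P * (CFC.log B - CFC.log C)).trace.re ≤ Real.log r * P.trace.re := by
    intro B C hB hC h P hP
    have h1 : CFC.log B ≤ CFC.log (r • C) := CFC.log_le_log h hB.isStrictlyPositive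
    rw [CFC.log_smul' C hr hC.isStrictlyPositive, Algebra.algebraMap_eq_smul_one] at h1
    have h2 := re_trace_mul_nonneg hP (Matrix.le_iff.1 h1)
    rw [show Real.log r • (1 : Matrix X X ℂ) + CFC.log C - CFC.log B =
      Real.log r • (1 : Matrix X X ℂ) - (CFC.log B - CFC.log C) by abel, mul_sub, trace_sub,
      Complex.sub_re, mul_smul_comm, mul_one, trace_smul] at h2
    simpa using h2
  have h1 := key hB hC hBC hP
  have h2 := key hC hB hCB hQ
  have h3 : (P - Q) * (CFC.log B - CFC.log C) =
      P * (CFC.log B - CFC.log C) + Q * (CFC.log C - CFC.log B) := by noncomm_ring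
  rw [h3, trace_add, Complex.add_re]
  linarith

theorem posDef_add_smul {X : Type*} [Fintype X] [DecidableEq X] {A D : Matrix X X ℂ}
    (hp : (A + D).PosDef) (hm : (A - D).PosDef) {t : ℝ} (h0 : -1 ≤ t) (h1 : t ≤ 1) :
    (A + t • D).PosDef := by
  have e : A + t • D = ((1 + t) / 2) • (A + D) + ((1 - t) / 2) • (A - D) := by
    module
  rw [e]
  rcases h1.eq_or_lt with rfl | h1
  · norm_num; exact hp
  · exact PosDef.posSemidef_add (hp.posSemidef.smul (by linarith)) (hm.smul (by linarith))

/-- The bound on the concavity defect when `A ± (P - Q)` are nonsingular, so that the logarithms are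
defined on the whole closed segment between them. -/
theorem two_mul_spectralEntropy_le_of_posDef {X : Type*} [Fintype X] [DecidableEq X]
    {A P Q : Matrix X X ℂ} (hP : P.PosSemidef) (hQ : Q.PosSemidef)
    (hp : (A + (P - Q)).PosDef) (hm : (A - (P - Q)).PosDef) :
    2 * spectralEntropy A ≤ spectralEntropy (A + (P - Q)) + spectralEntropy (A - (P - Q)) +
      2 * Real.log 2 * (P.trace.re + Q.trace.re) := by
  set D := P - Q with hD
  set d := P.trace.re + Q.trace.re with hd
  have hd0 : 0 ≤ d := add_nonneg (Complex.le_def.1 hP.trace_nonneg).1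
    (Complex.le_def.1 hQ.trace_nonneg).1
  have hpd : ∀ t : ℝ, -1 ≤ t → t ≤ 1 → (A + t • D).PosDef := fun t => posDef_add_smul hp hm
  let F : ℝ → ℝ := fun t => spectralEntropy (A + t • D)
  let c : ℝ → ℝ := fun t => Real.log ((1 + t) / (1 - t))
  let C : ℝ → ℝ := fun t => (1 + t) * Real.log (1 + t) + (1 - t) * Real.log (1 - t)
  have tangent : ∀ s t : ℝ, s ∈ Set.Icc (-1) 1 → t ∈ Set.Icc (-1) 1 →
      F s ≤ F t + (t - s) * (D * (CFC.log (A + t • D) + 1)).trace.re := by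
    intro s t hs ht
    have h := spectralEntropy_le_tangent (hpd s hs.1 hs.2).posSemidef (hpd t ht.1 ht.2)
    rwa [show A + t • D - (A + s • D) = (t - s) • D by module, smul_mul_assoc, trace_smul,
      Complex.smul_re, smul_eq_mul] at h
  have step : ∀ t u : ℝ, 0 ≤ t → t ≤ u → u < 1 →
      F t + F (-t) - (F u + F (-u)) ≤ (u - t) * (c u * d) := by
    intro t u ht htu hu
    have h1 := tangent t u ⟨by linarith, by linarith⟩ ⟨by linarith, by linarith⟩
    have h2 := tangent (-t) (-u) ⟨by linarith, by linarith⟩ ⟨by linarith, by linarith⟩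
    have hu' : (0 : ℝ) < 1 - u := by linarith
    -- `(1 + u) (A ∓ u D) - (1 - u) (A ± u D) = 2 u (A ∓ D)` is positive.
    have hle : ∀ {E : Matrix X X ℂ}, (A - E).PosSemidef →
        A + u • E ≤ ((1 + u) / (1 - u)) • (A - u • E) := by
      intro E hE
      rw [Matrix.le_iff]
      have : ((1 + u) / (1 - u)) • (A - u • E) - (A + u • E) = (2 * u / (1 - u)) • (A - E) := by
        match_scalars <;> field_simp <;> ring
      rw [this]
      exact hE.smul (div_nonneg (by linarith) hu'.le)
    have h3 := re_trace_mul_log_sub_log_le hP hQ (hpd u (by linarith) hu.le)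
      (hpd (-u) (by linarith) (by linarith)) (r := (1 + u) / (1 - u)) (by
        apply div_pos <;> linarith)
      (by simpa [sub_eq_add_neg] using hle hm.posSemidef)
      (by simpa [sub_eq_add_neg] using hle (E := -D) (by simpa using hp.posSemidef))
    have h4 : D * (CFC.log (A + u • D) - CFC.log (A + (-u) • D)) =
        D * (CFC.log (A + u • D) + 1) - D * (CFC.log (A + (-u) • D) + 1) := by noncomm_ring
    rw [← hD, ← hd, h4, trace_sub, Complex.sub_re] at h3
    have h5 := mul_le_mul_of_nonneg_left h3 (sub_nonneg.2 htu)
    simp only [c]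
    linarith
  -- Here `C` is the primitive of `c` that vanishes at `0`.
  have inner : ∀ T : ℝ, 0 ≤ T → T < 1 → 2 * F 0 - (F T + F (-T)) ≤ d * C T := by
    intro T h0 h1
    have h := le_of_increment_le (f := fun t => -(F t + F (-t)) - d * C t)
      (g := fun t => d * c t) h0 (by
        intro x y hx hxy hy
        have s1 := step x y hx hxy (by linarith)
        have s2 := mul_le_mul_of_nonneg_left (sub_mul_log_div_le hx hxy (by linarith)) hd0
        simp only [c, C] at s1 s2 ⊢
        linarith)
    simp [C] at h ⊢
    linarith
  -- `c` blows up at `1`, so the end points are reached from `± T` by one more tangent, whose slope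
  -- is finite because `A ± D` are nonsingular.
  have outer : ∀ T : ℝ, 0 ≤ T → T < 1 → 2 * F 0 - (F 1 + F (-1)) ≤ 2 * Real.log 2 * d +
      (1 - T) * ((D * (CFC.log (A + (1 : ℝ) • D) + 1)).trace.re -
        (D * (CFC.log (A + (-1 : ℝ) • D) + 1)).trace.re) := by
    intro T h0 h1
    have a1 := inner T h0 h1
    have a2 := tangent T 1 ⟨by linarith, h1.le⟩ ⟨by norm_num, le_rfl⟩
    have a3 := tangent (-T) (-1) ⟨by linarith, by linarith⟩ ⟨le_rfl, by norm_num⟩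
    have b1 : C T ≤ 2 * Real.log 2 := by
      have c1 : Real.log (1 + T) ≤ Real.log 2 := Real.log_le_log (by linarith) (by linarith)
      have c2 : Real.log (1 - T) ≤ 0 := Real.log_nonpos (by linarith) (by linarith)
      have c3 : 0 ≤ Real.log (1 + T) := Real.log_nonneg (by linarith)
      simp only [C]
      nlinarith
    have b2 := mul_le_mul_of_nonneg_left b1 hd0
    linarith
  have hlim := le_of_tendsto_of_tendsto (f := fun _ : ℝ => 2 * F 0 - (F 1 + F (-1)))
    (b := nhdsWithin 1 (Set.Iio 1)) tendsto_const_nhds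
    (((by fun_prop : Continuous fun T : ℝ => 2 * Real.log 2 * d +
      (1 - T) * ((D * (CFC.log (A + (1 : ℝ) • D) + 1)).trace.re -
        (D * (CFC.log (A + (-1 : ℝ) • D) + 1)).trace.re)).tendsto 1).mono_left
          nhdsWithin_le_nhds) (by
      filter_upwards [Ioo_mem_nhdsLT (zero_lt_one' ℝ)] with T hT
      exact outer T hT.1.le hT.2)
  simp only [F, sub_self, zero_mul, add_zero, zero_smul, one_smul, neg_smul,
    ← sub_eq_add_neg] at hlim
  linarith

theorem continuous_spectralEntropy_add_smul_one {X : Type*} [Fintype X] [DecidableEq X]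
    {A : Matrix X X ℂ} (hA : A.IsHermitian) :
    Continuous fun s : ℝ => spectralEntropy (A + s • (1 : Matrix X X ℂ)) := by
  simp_rw [spectralEntropy_add_smul_one hA]
  exact continuous_finsetSum _ fun i _ => Real.continuous_negMulLog.comp (by fun_prop)

/-- The concavity defect of the von Neumann entropy at the midpoint of `A + (P - Q)` and
`A - (P - Q)` is bounded independently of the dimension. The singular case follows by adding `s • 1`
and letting `s` tend to `0`. -/
theorem two_mul_spectralEntropy_le {X : Type*} [Fintype X] [DecidableEq X]
    {A P Q : Matrix X X ℂ} (hA : A.IsHermitian) (hP : P.PosSemidef) (hQ : Q.PosSemidef)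
    (hp : (A + (P - Q)).PosSemidef) (hm : (A - (P - Q)).PosSemidef) :
    2 * spectralEntropy A ≤ spectralEntropy (A + (P - Q)) + spectralEntropy (A - (P - Q)) +
      2 * Real.log 2 * (P.trace.re + Q.trace.re) := by
  have hlim := le_of_tendsto_of_tendsto (b := nhdsWithin (0 : ℝ) (Set.Ioi 0))
    ((((continuous_spectralEntropy_add_smul_one hA).const_mul 2).tendsto 0).mono_left
      nhdsWithin_le_nhds)
    (((((continuous_spectralEntropy_add_smul_one hp.isHermitian).add
      (continuous_spectralEntropy_add_smul_one hm.isHermitian)).add_const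
        (2 * Real.log 2 * (P.trace.re + Q.trace.re))).tendsto 0).mono_left nhdsWithin_le_nhds) (by
      filter_upwards [self_mem_nhdsWithin] with s hs
      have hs1 : (s • (1 : Matrix X X ℂ)).PosDef := PosDef.one.smul hs
      have e1 : A + s • (1 : Matrix X X ℂ) + (P - Q) = A + (P - Q) + s • 1 := by abel
      have e2 : A + s • (1 : Matrix X X ℂ) - (P - Q) = A - (P - Q) + s • 1 := by abel
      have h := two_mul_spectralEntropy_le_of_posDef (A := A + s • (1 : Matrix X X ℂ)) hP hQ
        (by rw [e1]; exact PosDef.posSemidef_add hp hs1)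
        (by rw [e2]; exact PosDef.posSemidef_add hm hs1)
      rwa [e1, e2] at h)
  simpa using hlim

end

section

open scoped ComplexOrder
open Matrix

/-! ### Reduced density matrices -/

theorem reducedDensity_posSemidef {X H : Type*} [Fintype X] [NormedAddCommGroup H]
    [InnerProductSpace ℂ H] (Ψ : Composite X H) : (reducedDensity Ψ).PosSemidef :=
  (posSemidef_gram ℂ fun x => Ψ x).transpose

theorem posSemidef_half_smul_reducedDensity {X H : Type*} [Fintype X] [NormedAddCommGroup H]
    [InnerProductSpace ℂ H] (Ψ : Composite X H) :
    ((1 / 2 : ℝ) • reducedDensity Ψ).PosSemidef :=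
  (reducedDensity_posSemidef Ψ).smul (by norm_num)

theorem trace_reducedDensity {X H : Type*} [Fintype X] [NormedAddCommGroup H]
    [InnerProductSpace ℂ H] (Ψ : Composite X H) : (reducedDensity Ψ).trace.re = ‖Ψ‖ ^ 2 := by
  rw [PiLp.norm_sq_eq_of_L2]
  simp only [trace, diag, reducedDensity, of_apply, Complex.re_sum]
  exact Finset.sum_congr rfl fun x _ => by
    rw [inner_self_eq_norm_sq_to_K]; norm_cast

theorem entanglementEntropy_eq {X H : Type*} [Fintype X] [DecidableEq X] [NormedAddCommGroup H]
    [InnerProductSpace ℂ H] (Ψ : Composite X H) :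
    entanglementEntropy Ψ = spectralEntropy (reducedDensity Ψ) :=
  (spectralEntropy_eq_sum (reducedDensity_isHermitian Ψ)).symm

theorem norm_add_sq_add_norm_sub_sq {X H : Type*} [Fintype X] [NormedAddCommGroup H]
    [InnerProductSpace ℂ H] (Φ Λ : Composite X H) :
    ‖Φ + Λ‖ ^ 2 + ‖Φ - Λ‖ ^ 2 = 2 * (‖Φ‖ ^ 2 + ‖Λ‖ ^ 2) := by
  have := parallelogram_law_with_norm ℂ Φ Λ
  nlinarith

/-- The cross terms of `ρ(Φ + Λ)` as a difference of positive matrices. The free parameter `p`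
balances vectors of different norms. -/
theorem reducedDensity_add_eq {X H : Type*} [NormedAddCommGroup H] [InnerProductSpace ℂ H]
    (Φ Λ : Composite X H) {p : ℝ} (hp : p ≠ 0) :
    reducedDensity (Φ + Λ) = reducedDensity Φ + reducedDensity Λ +
      ((1 / 2 : ℝ) • reducedDensity (p • Φ + p⁻¹ • Λ) -
        (1 / 2 : ℝ) • reducedDensity (p • Φ - p⁻¹ • Λ)) := by
  have hp' : (p : ℂ) ≠ 0 := by exact_mod_cast hp
  ext x y
  simp only [reducedDensity, of_apply, Matrix.add_apply, Matrix.sub_apply,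
    Matrix.smul_apply, PiLp.add_apply,
    PiLp.sub_apply, PiLp.smul_apply, inner_add_left, inner_add_right, inner_sub_left,
    inner_sub_right, inner_smul_left_eq_smul, inner_smul_right_eq_smul,
    Complex.real_smul]
  push_cast
  field_simp
  ring

/-- Norm preservation implies, by polarization, preservation of the reduced density matrix of the
system on which the evolution does not act. -/
theorem reducedDensity_applyHole_add {X H H' : Type*} [NormedAddCommGroup H]
    [InnerProductSpace ℂ H] [NormedAddCommGroup H'] [InnerProductSpace ℂ H']
    {K₁ K₂ : H →ₗ[ℂ] H'} (hK : ∀ ψ : H, ‖K₁ ψ‖ ^ 2 + ‖K₂ ψ‖ ^ 2 = ‖ψ‖ ^ 2)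
    (Ψ : Composite X H) :
    reducedDensity (applyHole K₁ Ψ) + reducedDensity (applyHole K₂ Ψ) = reducedDensity Ψ := by
  ext x y
  have hK' : ∀ ψ : H, (‖ψ‖ : ℂ) ^ 2 = (‖K₁ ψ‖ : ℂ) ^ 2 + (‖K₂ ψ‖ : ℂ) ^ 2 := fun ψ => by
    exact_mod_cast (hK ψ).symm
  simp only [reducedDensity, applyHole, of_apply, Matrix.add_apply]
  rw [inner_eq_sum_norm_sq_div_four (Ψ y), inner_eq_sum_norm_sq_div_four (K₁ (Ψ y)),
    inner_eq_sum_norm_sq_div_four (K₂ (Ψ y))]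
  simp only [Complex.coe_algebraMap, hK', map_add, map_sub, map_smul]
  ring

/-- `ℂ^R ⊗ ℂ²` as the direct sum of two copies of `ℂ^R`, on the level of basis indices; the left
summand belongs to the index `0` of the second factor. -/
def sumEquivProdFinTwo (R : Type*) : R ⊕ R ≃ R × Fin 2 where
  toFun := Sum.elim (fun a => (a, 0)) (fun a => (a, 1))
  invFun p := if p.2 = 0 then Sum.inl p.1 else Sum.inr p.1
  left_inv := by rintro (a | a) <;> simp
  right_inv := by rintro ⟨a, i⟩; fin_cases i <;> simp

/-- The infalling quantum carries the same index as the outgoing one, so tracing it out removes the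
coherence between the two values of that index. -/
theorem reducedDensity_pairTensor {R H : Type*} [NormedAddCommGroup H] [InnerProductSpace ℂ H]
    (Λ₁ Λ₂ : Composite R H) :
    (reducedDensity (pairTensor bellPlus Λ₁ + pairTensor bellMinus Λ₂)).submatrix
      (sumEquivProdFinTwo R) (sumEquivProdFinTwo R) =
      fromBlocks ((1 / 2 : ℝ) • reducedDensity (Λ₁ + Λ₂)) 0 0
        ((1 / 2 : ℝ) • reducedDensity (Λ₁ - Λ₂)) := by
  have hs : ((Real.sqrt 2 : ℝ) : ℂ)⁻¹ * ((Real.sqrt 2 : ℝ) : ℂ)⁻¹ = 2⁻¹ := by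
    rw [← mul_inv]
    congr 1
    exact_mod_cast Real.mul_self_sqrt zero_le_two
  have h0 : ∀ (a : R), (pairTensor bellPlus Λ₁ + pairTensor bellMinus Λ₂) (a, 0) =
      WithLp.toLp 2 ![((Real.sqrt 2 : ℝ) : ℂ)⁻¹ • (Λ₁ a + Λ₂ a), 0] := by
    intro a
    ext l
    fin_cases l <;> simp [pairTensor, bellPlus, bellMinus, smul_add]
  have h1 : ∀ (a : R), (pairTensor bellPlus Λ₁ + pairTensor bellMinus Λ₂) (a, 1) =
      WithLp.toLp 2 ![0, ((Real.sqrt 2 : ℝ) : ℂ)⁻¹ • (Λ₁ a - Λ₂ a)] := by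
    intro a
    ext l
    fin_cases l <;> simp [pairTensor, bellPlus, bellMinus, sub_eq_add_neg]
  ext (x | x) (y | y) <;>
    simp only [submatrix_apply, sumEquivProdFinTwo, Equiv.coe_fn_mk, Sum.elim_inl, Sum.elim_inr,
      reducedDensity, of_apply, h0, h1, PiLp.inner_apply, Fin.sum_univ_two, fromBlocks_apply₁₁,
      fromBlocks_apply₁₂, fromBlocks_apply₂₁, fromBlocks_apply₂₂] <;>
    simp [inner_add_left, inner_add_right, inner_sub_left, inner_sub_right, inner_smul_left,
      inner_smul_right, mul_add, mul_sub, ← mul_assoc, hs]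

theorem entanglementEntropy_pairTensor {R H : Type*} [Fintype R] [DecidableEq R]
    [NormedAddCommGroup H] [InnerProductSpace ℂ H]
    (Λ₁ Λ₂ : Composite R H) (h : ‖Λ₁‖ ^ 2 + ‖Λ₂‖ ^ 2 = 1) :
    entanglementEntropy (pairTensor bellPlus Λ₁ + pairTensor bellMinus Λ₂) =
      (spectralEntropy (reducedDensity (Λ₁ + Λ₂)) + spectralEntropy (reducedDensity (Λ₁ - Λ₂))) / 2
        + Real.log 2 := by
  rw [entanglementEntropy_eq, ← spectralEntropy_submatrix_equiv _ (sumEquivProdFinTwo R),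
    reducedDensity_pairTensor, spectralEntropy_fromBlocks,
    spectralEntropy_smul (reducedDensity_isHermitian _),
    spectralEntropy_smul (reducedDensity_isHermitian _), trace_reducedDensity,
    trace_reducedDensity]
  have hn : Real.negMulLog (1 / 2) = Real.log 2 / 2 := by
    rw [Real.negMulLog, one_div, Real.log_inv]; ring
  have := norm_add_sq_add_norm_sub_sq Λ₁ Λ₂
  rw [h] at this
  rw [hn]
  linear_combination Real.log 2 / 2 * this

end

theorem mainTheorem1 {R H H' : Type*} [Fintype R] [DecidableEq R]
    [NormedAddCommGroup H] [InnerProductSpace ℂ H]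
    [NormedAddCommGroup H'] [InnerProductSpace ℂ H']
    (Ψ : Composite R H) (hΨ : ‖Ψ‖ = 1)
    (K₁ K₂ : H →ₗ[ℂ] H') (hK : ∀ ψ : H, ‖K₁ ψ‖ ^ 2 + ‖K₂ ψ‖ ^ 2 = ‖ψ‖ ^ 2)
    (Λ₁ Λ₂ : Composite R H') (hΛ₁ : Λ₁ = applyHole K₁ Ψ) (hΛ₂ : Λ₂ = applyHole K₂ Ψ)
    (S₀ : ℝ) (hS₀ : S₀ = entanglementEntropy Ψ)
    (ε : ℝ) (hε : ‖Λ₂‖ < ε) :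
    entanglementEntropy (pairTensor bellPlus Λ₁ + pairTensor bellMinus Λ₂) >
      S₀ + Real.log 2 - 2 * ε := by
  have hρ : reducedDensity Λ₁ + reducedDensity Λ₂ = reducedDensity Ψ := by
    rw [hΛ₁, hΛ₂, reducedDensity_applyHole_add hK]
  have hnorm : ‖Λ₁‖ ^ 2 + ‖Λ₂‖ ^ 2 = 1 := by
    rw [← trace_reducedDensity, ← trace_reducedDensity, ← Complex.add_re, ← Matrix.trace_add, hρ,
      trace_reducedDensity, hΨ, one_pow]
  have hε0 : 0 < ε := (norm_nonneg _).trans_lt hε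
  -- Rescaling `Λ₁` by `√ε` and `Λ₂` by `1 / √ε` gives both norm at most `√ε`, so that `P` and `Q`
  -- have traces of order `ε`.
  have hp0 : Real.sqrt ε ≠ 0 := (Real.sqrt_pos.2 hε0).ne'
  set P := (1 / 2 : ℝ) • reducedDensity (Real.sqrt ε • Λ₁ + (Real.sqrt ε)⁻¹ • Λ₂) with hP
  set Q := (1 / 2 : ℝ) • reducedDensity (Real.sqrt ε • Λ₁ - (Real.sqrt ε)⁻¹ • Λ₂) with hQ
  have hadd : reducedDensity (Λ₁ + Λ₂) = reducedDensity Ψ + (P - Q) := by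
    rw [reducedDensity_add_eq Λ₁ Λ₂ hp0, hρ]
  have hsub : reducedDensity (Λ₁ - Λ₂) = reducedDensity Ψ - (P - Q) := by
    have hneg : reducedDensity (-Λ₂) = reducedDensity Λ₂ := by ext; simp [reducedDensity]
    rw [sub_eq_add_neg, reducedDensity_add_eq Λ₁ (-Λ₂) hp0, hneg, hρ, hP, hQ, smul_neg,
      sub_neg_eq_add, ← sub_eq_add_neg]
    abel
  have htr : P.trace.re + Q.trace.re < 2 * ε := by
    have h1 : P.trace.re + Q.trace.re = ε * ‖Λ₁‖ ^ 2 + ε⁻¹ * ‖Λ₂‖ ^ 2 := by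
      rw [hP, hQ, Matrix.trace_smul, Matrix.trace_smul, Complex.smul_re, Complex.smul_re,
        trace_reducedDensity, trace_reducedDensity, ← smul_add, norm_add_sq_add_norm_sub_sq,
        norm_smul, norm_smul, mul_pow, mul_pow, norm_inv, inv_pow, Real.norm_eq_abs, sq_abs,
        Real.sq_sqrt hε0.le, smul_eq_mul]
      ring
    have h2 : ε⁻¹ * ‖Λ₂‖ ^ 2 < ε := by
      rw [inv_mul_lt_iff₀ hε0]
      nlinarith [norm_nonneg Λ₂]
    rw [h1]
    nlinarith [sq_nonneg ‖Λ₂‖]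
  have hgap := two_mul_spectralEntropy_le (reducedDensity_isHermitian Ψ) (P := P) (Q := Q)
    (posSemidef_half_smul_reducedDensity _) (posSemidef_half_smul_reducedDensity _)
    (hadd ▸ reducedDensity_posSemidef _) (hsub ▸ reducedDensity_posSemidef _)
  rw [entanglementEntropy_pairTensor Λ₁ Λ₂ hnorm, hS₀, entanglementEntropy_eq, hadd, hsub]
  have hlog0 : 0 < Real.log 2 := Real.log_pos one_lt_two
  have hlog1 : Real.log 2 < 1 := Real.log_two_lt_d9.trans (by norm_num)
  nlinarith
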